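/- Let $\mathbb K=\mathbb R$ or $\mathbb K=\mathbb C$, and let $1\le k\le d$ and $n$ be integers. For an instance $\mathcal A=(A_1,\dots,A_d)$ of positive semidefinite (symmetric, resp. Hermitian) matrices $A_i\in\mathbb K^{n\times n}$, let $\mathcal S_k$ be the set of all $k$-element subsets of $\{1,\dots,d\}$ and define the value of the degree-$k$ sum-of-squares relaxation $$\mathrm{OptSoS}_k(\mathcal A)=\inf\Bigl\{\lambda^{1/k}\;:\;\lambda\|x\|^{2k}-\binom dk^{-1}\sum_{I\in\mathcal S_k}\alpha_I\prod_{i\in I}\langle x,A_ix\rangle\ \text{is a sum of squares},\ \prod_{I\in\mathcal S_k}\alpha_I\ge 1,\ \alpha_I>0\Bigr\},$$ the infimum being over $\lambda\in\mathbb R$ and $(\alpha_I)_{I\in\mathcal S_k}$, where $x$ ranges over $\mathbb K^n$, $\langle x,A_ix\rangle=x^\dagger A_ix$, and "sum of squares" means a finite sum of squares of polynomials with real coefficients in the coordinates of $x$ if $\mathbb K=\mathbb R$, and in the real and imaginary parts of the coordinates of $x$ if $\mathbb K=\mathbb C$. Let $v_1,\dots,v_d\in\mathbb K^n$ be unit vectors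 and $\mathcal A=(v_1v_1^\dagger,\dots,v_dv_d^\dagger)$. Then $$\mathrm{OptSoS}_k(\mathcal A)\ \ge\ \frac1{n+k-1}.$$ -/

import Mathlib

noncomputable section

/-- The `ℝ`-algebra of real-valued polynomial functions on `𝕜ⁿ`, with `𝕜ⁿ` regarded as a real
vector space: it is generated by the real and imaginary parts of the coordinates. For `𝕜 = ℝ`
these are the polynomials in `x₁, …, xₙ`, as the imaginary parts vanish; for `𝕜 = ℂ` these are
the polynomials in the `2n` real variables `Re xᵢ`, `Im xᵢ`. -/
def realPolyFun (𝕜 : Type*) [RCLike 𝕜] (n : ℕ) :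
    Subalgebra ℝ (EuclideanSpace 𝕜 (Fin n) → ℝ) :=
  Algebra.adjoin ℝ
    (Set.range (fun (i : Fin n) (x : EuclideanSpace 𝕜 (Fin n)) => RCLike.re (x i)) ∪
      Set.range (fun (i : Fin n) (x : EuclideanSpace 𝕜 (Fin n)) => RCLike.im (x i)))

/-- `f` is a (finite) sum of squares of real polynomials on `𝕜ⁿ`. -/
def IsSOS {𝕜 : Type*} [RCLike 𝕜] {n : ℕ} (f : EuclideanSpace 𝕜 (Fin n) → ℝ) : Prop :=
  ∃ (m : ℕ) (s : Fin m → EuclideanSpace 𝕜 (Fin n) → ℝ),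
    (∀ j, s j ∈ realPolyFun 𝕜 n) ∧ ∀ x, f x = ∑ j, s j x ^ 2

/-- The form `⟨x, A x⟩ = x† A x`, which is real when `A` is Hermitian. -/
def hermForm {𝕜 : Type*} [RCLike 𝕜] {n : ℕ} (A : Matrix (Fin n) (Fin n) 𝕜)
    (x : EuclideanSpace 𝕜 (Fin n)) : ℝ :=
  RCLike.re (star x.ofLp ⬝ᵥ A.mulVec x.ofLp)

/-- `(lam, α)` is feasible for the degree-`k` relaxation of the instance `A₁, …, A_d`. The
multipliers `α_I` are indexed by the `k`-element subsets `I` of the `d` indices; the values of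
`α` on other sets play no role. -/
structure IsSOSFeasible {𝕜 : Type*} [RCLike 𝕜] {n d : ℕ}
    (A : Fin d → Matrix (Fin n) (Fin n) 𝕜) (k : ℕ) (lam : ℝ) (α : Finset (Fin d) → ℝ) :
    Prop where
  pos : ∀ I ∈ Finset.powersetCard k (Finset.univ : Finset (Fin d)), 0 < α I
  one_le_prod : 1 ≤ ∏ I ∈ Finset.powersetCard k (Finset.univ : Finset (Fin d)), α I
  isSOS : IsSOS fun x : EuclideanSpace 𝕜 (Fin n) =>
    lam * ‖x‖ ^ (2 * k) -
      ((d.choose k : ℝ))⁻¹ *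
        ∑ I ∈ Finset.powersetCard k (Finset.univ : Finset (Fin d)),
          α I * ∏ i ∈ I, hermForm (A i) x

/-- The value of the degree-`k` sum-of-squares relaxation: the infimum of `lam ^ (1 / k)` over
all feasible `(lam, α)`. -/
def optSOS {𝕜 : Type*} [RCLike 𝕜] {n d : ℕ}
    (A : Fin d → Matrix (Fin n) (Fin n) 𝕜) (k : ℕ) : ℝ :=
  sInf {t : ℝ | ∃ (lam : ℝ) (α : Finset (Fin d) → ℝ),
    IsSOSFeasible A k lam α ∧ t = lam ^ (1 / (k : ℝ))}

end

/-!
Every sum of squares is nonnegative, so a feasible point `(lam, α)` satisfies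
`(d choose k)⁻¹ ∑_I α_I ∏_{i ∈ I} |⟨vᵢ, x⟩|² ≤ lam ‖x‖^{2k}` for all `x`, and this inequality can be
averaged over a standard Gaussian vector `x`. Regard `𝕜ⁿ` as a real inner product space of dimension
`N = m n`, with `m = 1` or `m = 2`. The right-hand side averages to `lam N (N + 2) ⋯ (N + 2k - 2)`
(`gaussE_normSqPoly_pow`), which by the arithmetic-geometric mean inequality is at most
`lam m^k (n + k - 1)^k` (`prod_range_add_two_mul_le`).

On the left, `|⟨v, x⟩|²` is a sum of squares of `m` real linear forms of unit vectors
(`hermForm_vecMulVec_eq_sum`), so each product over `I` expands into `m^k` products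
`∏ᵢ ⟨uᵢ, x⟩²` with `uᵢ` real unit vectors. Each of these has expectation at least `1`, by the Gaussian
product inequality for squares (`one_le_gaussE_prod_linForm_sq`). Since `∏ α_I ≥ 1`, the mean of the
`α_I` is at least `1`, so the left-hand side averages to at least `m^k`, and
`lam ≥ (n + k - 1)^{-k}` follows (`one_le_mul_pow_of_isSOSFeasible`).

For the Gaussian product inequality, let `p` be a product of linear forms and `W` its Wick product.
Integration by parts gives `E[W q] = ⟨p, q⟩` for every polynomial `q` of degree at most that of `p`,
with `⟨·, ·⟩` the Fischer form (`gaussE_wick_mul`). As `W - p` has lower degree, it is Fischer-orthogonal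
to `p`, and `E[(p - W)²] ≥ 0` becomes `E[p²] ≥ ⟨p, p⟩` (`fischer_le_gaussE_sq`). Finally
`⟨p, p⟩ ≥ 1`: multiplication by the form of a unit vector does not decrease the Fischer norm, since its
adjoint is the derivative in the direction of the vector (`one_le_fischer_prodLinForm`).

The infimum of the empty set of reals is `0`, so a feasible point is needed as well: `lam = 1` and
`α = 1` will do (`isSOSFeasible_one`).
-/

open MeasureTheory ProbabilityTheory MvPolynomial

/-! ### Moments of the standard Gaussian law on the line -/

theorem integrable_pow_gaussianReal (a : ℕ) :
    Integrable (fun x : ℝ => x ^ a) (gaussianReal 0 1) := by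
  have h := (memLp_id_gaussianReal (μ := 0) (v := 1) a).integrable_norm_pow' (f := id)
  refine Integrable.mono' h (by fun_prop) (.of_forall fun x => by simp)

theorem hasDerivAt_gaussianPDFReal (x : ℝ) :
    HasDerivAt (gaussianPDFReal 0 1) (-x * gaussianPDFReal 0 1 x) x := by
  have h : HasDerivAt (fun y : ℝ => -y ^ 2 / 2) (-x) x := by
    have := ((hasDerivAt_pow 2 x).neg.div_const 2)
    exact this.congr_deriv (by simp; ring)
  have h2 := (h.exp.const_mul (√(2 * Real.pi * 1))⁻¹)
  have e : gaussianPDFReal 0 1 = fun y => (√(2 * Real.pi * 1))⁻¹ * Real.exp (-y ^ 2 / 2) := by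
    ext y; simp [gaussianPDFReal]
  rw [e]
  exact h2.congr_deriv (by ring)

/-- The recursion for the moments of the standard Gaussian law. For `a = 0` the right-hand side
vanishes because of its first factor. -/
theorem integral_pow_succ_gaussianReal (a : ℕ) :
    ∫ x, x ^ (a + 1) ∂gaussianReal 0 1 = a * ∫ x, x ^ (a - 1) ∂gaussianReal 0 1 := by
  have hi : ∀ b : ℕ, Integrable (fun x : ℝ => gaussianPDFReal 0 1 x * x ^ b) := fun b => by
    have h := integrable_pow_gaussianReal b
    rw [gaussianReal_of_var_ne_zero 0 one_ne_zero,
      integrable_withDensity_iff_integrable_smul' (measurable_gaussianPDF 0 1)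
        (.of_forall fun _ => gaussianPDF_lt_top)] at h
    simpa [toReal_gaussianPDF] using h
  have hd : ∀ x : ℝ, HasDerivAt (fun x => x ^ a * gaussianPDFReal 0 1 x)
      (a * (gaussianPDFReal 0 1 x * x ^ (a - 1)) - gaussianPDFReal 0 1 x * x ^ (a + 1)) x := by
    intro x
    exact ((hasDerivAt_pow a x).mul (hasDerivAt_gaussianPDFReal x)).congr_deriv (by ring)
  have h0 := integral_eq_zero_of_hasDerivAt_of_integrable hd
    (((hi (a - 1)).const_mul (a : ℝ)).sub (hi (a + 1))) ((hi a).congr (.of_forall fun x => mul_comm _ _))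
  rw [integral_sub ((hi (a - 1)).const_mul (a : ℝ)) (hi (a + 1)), integral_const_mul] at h0
  simp only [integral_gaussianReal_eq_integral_smul one_ne_zero, smul_eq_mul]
  linarith

section GaussianPolynomials

/-! ### Polynomials of bounded degree -/

variable {σ : Type*}

/-- All monomials of `p` have total degree less than `m`. -/
def DegLT (m : ℕ) (p : MvPolynomial σ ℝ) : Prop :=
  ∀ α : σ →₀ ℕ, m ≤ α.degree → coeff α p = 0

namespace DegLT

variable {m : ℕ} {p q : MvPolynomial σ ℝ}

theorem mono {m' : ℕ} (hp : DegLT m p) (h : m ≤ m') : DegLT m' p := fun α hα => hp α (h.trans hα)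

theorem add (hp : DegLT m p) (hq : DegLT m q) : DegLT m (p + q) := fun α hα => by
  simp [hp α hα, hq α hα]

theorem sub (hp : DegLT m p) (hq : DegLT m q) : DegLT m (p - q) := fun α hα => by
  simp [hp α hα, hq α hα]

theorem eq_zero (hp : DegLT 0 p) : p = 0 := MvPolynomial.ext _ _ fun α => by
  simpa using hp α (Nat.zero_le _)

theorem eq_C (hp : DegLT 1 p) : p = C (coeff 0 p) := MvPolynomial.ext _ _ fun α => by
  classical
  rw [coeff_C]
  split_ifs with h
  · rw [h]
  · exact hp α (Nat.one_le_iff_ne_zero.2 fun h' => h ((Finsupp.degree_eq_zero_iff α).1 h').symm)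

end DegLT

variable [Fintype σ]

/-! ### Gaussian expectations of polynomials -/

/-- The standard Gaussian measure on `ℝ^σ`. -/
noncomputable abbrev stdGauss (σ : Type*) [Fintype σ] : Measure (σ → ℝ) :=
  Measure.pi fun _ => gaussianReal 0 1

theorem integrable_eval_stdGauss (p : MvPolynomial σ ℝ) :
    Integrable (fun x => eval x p) (stdGauss σ) := by
  induction p using MvPolynomial.induction_on' with
  | monomial α c =>
    simp only [eval_monomial, Finsupp.prod_fintype _ _ (fun _ => pow_zero _)]
    exact (Integrable.fintype_prod (f := fun s (y : ℝ) => y ^ α s)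
      fun s => integrable_pow_gaussianReal (α s)).const_mul c
  | add p q hp hq =>
    simp only [map_add]
    exact hp.add hq

/-- The expectation of a polynomial in independent standard Gaussian variables. -/
noncomputable def gaussE : MvPolynomial σ ℝ →ₗ[ℝ] ℝ where
  toFun p := ∫ x, eval x p ∂stdGauss σ
  map_add' p q := by
    simp only [map_add]
    exact integral_add (integrable_eval_stdGauss p) (integrable_eval_stdGauss q)
  map_smul' c p := by simp [integral_const_mul]

theorem gaussE_C (c : ℝ) : gaussE (C c : MvPolynomial σ ℝ) = c := by
  simp [gaussE]

theorem gaussE_mono {p q : MvPolynomial σ ℝ} (h : ∀ x, eval x p ≤ eval x q) :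
    gaussE p ≤ gaussE q :=
  integral_mono (integrable_eval_stdGauss p) (integrable_eval_stdGauss q) h

theorem gaussE_sq_nonneg (p : MvPolynomial σ ℝ) : 0 ≤ gaussE (p * p) := by
  simpa using gaussE_mono (p := 0) (q := p * p) fun x => by simpa using mul_self_nonneg _

theorem gaussE_monomial (α : σ →₀ ℕ) (c : ℝ) :
    gaussE (monomial α c) = c * ∏ s, ∫ x, x ^ α s ∂gaussianReal 0 1 := by
  change ∫ x, eval x (monomial α c) ∂stdGauss σ = _
  simp only [eval_monomial, Finsupp.prod_fintype _ _ (fun _ => pow_zero _), integral_const_mul]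
  rw [integral_fintype_prod_eq_prod (fun s (y : ℝ) => y ^ α s)]

/-- Gaussian integration by parts (Stein's identity) for polynomials. -/
theorem gaussE_X_mul (i : σ) (p : MvPolynomial σ ℝ) :
    gaussE (X i * p) = gaussE (pderiv i p) := by
  classical
  induction p using MvPolynomial.induction_on' with
  | monomial α c =>
    rw [pderiv_monomial, X, monomial_mul, gaussE_monomial, gaussE_monomial,
      ← Finset.mul_prod_erase _ _ (Finset.mem_univ i),
      ← Finset.mul_prod_erase _ _ (Finset.mem_univ i)]
    have h : ∀ s ∈ Finset.univ.erase i, (∫ x, x ^ ((Finsupp.single i 1 + α : σ →₀ ℕ) s) ∂gaussianReal 0 1) =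
        ∫ x, x ^ ((α - Finsupp.single i 1 : σ →₀ ℕ) s) ∂gaussianReal 0 1 := fun s hs => by
      simp [Finsupp.single_eq_of_ne (Finset.ne_of_mem_erase hs)]
    rw [Finset.prod_congr rfl h]
    simp only [Finsupp.add_apply, Finsupp.single_eq_same, Finsupp.tsub_apply, add_comm 1,
      integral_pow_succ_gaussianReal]
    ring
  | add p q hp hq => simp only [mul_add, map_add, hp, hq]

/-! ### Linear forms and directional derivatives -/

/-- The linear form `x ↦ ∑ₛ vₛ xₛ` as a polynomial. -/
noncomputable def linForm (v : σ → ℝ) : MvPolynomial σ ℝ := ∑ s, v s • X s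

/-- The derivative of polynomials in the direction `v`. -/
noncomputable def dirDeriv (v : σ → ℝ) : Derivation ℝ (MvPolynomial σ ℝ) (MvPolynomial σ ℝ) :=
  mkDerivation ℝ fun s => C (v s)

theorem dirDeriv_eq_sum (v : σ → ℝ) (p : MvPolynomial σ ℝ) :
    dirDeriv v p = ∑ s, v s • pderiv s p := by
  classical
  induction p using MvPolynomial.induction_on with
  | C c => simp
  | add p q hp hq => simp only [map_add, hp, hq, smul_add, Finset.sum_add_distrib]
  | mul_X p i hp =>
    simp only [Derivation.leibniz, hp, smul_add, Finset.sum_add_distrib, Finset.smul_sum]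
    congr 1
    · simp [dirDeriv, mkDerivation_X, pderiv_X, Pi.single_apply, smul_eq_C_mul, mul_comm]
    · exact Finset.sum_congr rfl fun s _ => smul_comm _ _ _

theorem dirDeriv_linForm (v w : σ → ℝ) : dirDeriv v (linForm w) = C (∑ s, w s * v s) := by
  simp [linForm, dirDeriv, mkDerivation_X, smul_eq_C_mul]

theorem gaussE_linForm_mul (v : σ → ℝ) (p : MvPolynomial σ ℝ) :
    gaussE (linForm v * p) = gaussE (dirDeriv v p) := by
  simp only [linForm, dirDeriv_eq_sum, Finset.sum_mul, smul_mul_assoc, map_sum, map_smul,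
    gaussE_X_mul]

/-- The polynomial `‖x‖²`. -/
noncomputable def normSqPoly (σ : Type*) [Fintype σ] : MvPolynomial σ ℝ := ∑ s, X s ^ 2

/-- The even moments of the Euclidean norm of a standard Gaussian vector. -/
theorem gaussE_normSqPoly_pow (k : ℕ) :
    gaussE (normSqPoly σ ^ k) = ∏ j ∈ Finset.range k, ((Fintype.card σ : ℝ) + 2 * j) := by
  induction k with
  | zero => simpa using gaussE_C (σ := σ) 1
  | succ k ih =>
    have hp : ∀ s : σ, pderiv s (normSqPoly σ) = 2 * X s := fun s => by
      classical
      simp [normSqPoly, pderiv_X, Pi.single_apply, Derivation.leibniz_pow]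
    have h1 : ∀ s : σ, pderiv s (X s * normSqPoly σ ^ k) =
        normSqPoly σ ^ k + (2 * k : ℝ) • (X s ^ 2 * normSqPoly σ ^ (k - 1)) := fun s => by
      simp only [Derivation.leibniz, Derivation.leibniz_pow, hp, pderiv_X_self, smul_eq_mul,
        nsmul_eq_mul, smul_eq_C_mul, map_mul, map_natCast, map_ofNat]
      ring
    have h2 : (k : ℝ) * gaussE (normSqPoly σ * normSqPoly σ ^ (k - 1)) =
        k * gaussE (normSqPoly σ ^ k) := by
      rcases k with _ | k
      · simp
      · rw [Nat.add_sub_cancel, ← pow_succ']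
    rw [Finset.prod_range_succ, ← ih, pow_succ']
    have h3 : normSqPoly σ * normSqPoly σ ^ k = ∑ s, X s * (X s * normSqPoly σ ^ k) := by
      conv_lhs => enter [1]; rw [normSqPoly]
      simp only [Finset.sum_mul, sq, mul_assoc]
    have h4 : ∑ s : σ, gaussE (X s ^ 2 * normSqPoly σ ^ (k - 1)) =
        gaussE (normSqPoly σ * normSqPoly σ ^ (k - 1)) := by
      rw [← map_sum, ← Finset.sum_mul, ← normSqPoly]
    simp_rw [h3, map_sum, gaussE_X_mul, h1, map_add, map_smul]
    rw [Finset.sum_add_distrib, ← Finset.smul_sum, h4]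
    simp only [Finset.sum_const, Finset.card_univ, nsmul_eq_mul, smul_eq_mul]
    linear_combination 2 * h2

/-! ### The Fischer form -/

/-- The Fischer (Bombieri) inner product `∑_α α! p_α q_α` on polynomials. -/
noncomputable def fischer (p q : MvPolynomial σ ℝ) : ℝ :=
  ∑ α ∈ p.support, (∏ s, ((α s).factorial : ℝ)) * (coeff α p * coeff α q)

theorem fischer_comm (p q : MvPolynomial σ ℝ) : fischer p q = fischer q p := by
  classical
  have h : ∀ p q : MvPolynomial σ ℝ, fischer p q = ∑ α ∈ p.support ∪ q.support,
      (∏ s, ((α s).factorial : ℝ)) * (coeff α p * coeff α q) := fun p q =>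
    Finset.sum_subset Finset.subset_union_left fun α _ h => by simp [notMem_support_iff.1 h]
  rw [h, h, Finset.union_comm]
  simp only [mul_comm (coeff _ p)]

theorem fischer_self_nonneg (p : MvPolynomial σ ℝ) : 0 ≤ fischer p p :=
  Finset.sum_nonneg fun α _ => mul_nonneg (by positivity) (mul_self_nonneg _)

/-- The Fischer form as a linear map in its second argument. -/
noncomputable def fischerLin (p : MvPolynomial σ ℝ) : MvPolynomial σ ℝ →ₗ[ℝ] ℝ where
  toFun q := fischer p q
  map_add' q r := by simp [fischer, mul_add, Finset.sum_add_distrib]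
  map_smul' c q := by
    simp only [fischer, coeff_smul, smul_eq_mul, RingHom.id_apply, Finset.mul_sum]
    exact Finset.sum_congr rfl fun _ _ => by ring

theorem fischer_X_mul (i : σ) (p q : MvPolynomial σ ℝ) :
    fischer (X i * p) q = fischer p (pderiv i q) := by
  classical
  rw [fischer, fischer, support_X_mul, Finset.sum_map]
  refine Finset.sum_congr rfl fun α _ => ?_
  have h : ∏ s, (((Finsupp.single i 1 + α : σ →₀ ℕ) s).factorial : ℝ) =
      (α i + 1) * ∏ s, ((α s).factorial : ℝ) := by
    rw [← Finset.mul_prod_erase _ _ (Finset.mem_univ i),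
      ← Finset.mul_prod_erase (a := i) _ _ (Finset.mem_univ i), ← mul_assoc]
    congr 1
    · simp [add_comm 1, Nat.factorial_succ]
    · exact Finset.prod_congr rfl fun s hs => by
        simp [Finsupp.single_eq_of_ne (Finset.ne_of_mem_erase hs)]
  rw [addLeftEmbedding_apply, coeff_X_mul, coeff_pderiv, h, add_comm (Finsupp.single i 1)]
  ring

/-- Multiplication by a linear form and the derivative in its direction are adjoint for the
Fischer form. -/
theorem fischer_linForm_mul (v : σ → ℝ) (p q : MvPolynomial σ ℝ) :
    fischer (linForm v * p) q = fischer p (dirDeriv v q) := by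
  have h : fischer p (dirDeriv v q) = ∑ s, v s * fischer p (pderiv s q) := by
    change fischerLin p _ = _
    rw [dirDeriv_eq_sum, map_sum]
    simp only [map_smul, smul_eq_mul]; rfl
  rw [h, fischer_comm]
  change fischerLin q _ = _
  simp only [linForm, Finset.sum_mul, smul_mul_assoc, map_sum, map_smul, smul_eq_mul,
    ← fischer_X_mul]
  exact Finset.sum_congr rfl fun s _ => congrArg _ (fischer_comm _ _)

/-- The product of the linear forms with the given coefficient vectors. -/
noncomputable def prodLinForm (l : List (σ → ℝ)) : MvPolynomial σ ℝ := (l.map linForm).prod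

/-- The commutation relation between multiplication by a linear form and its adjoint. For a unit
vector `v` it shows that multiplication by `linForm v` does not decrease the Fischer norm. -/
theorem fischer_linForm_mul_self (v : σ → ℝ) (p : MvPolynomial σ ℝ) :
    fischer (linForm v * p) (linForm v * p) =
      (∑ s, v s * v s) * fischer p p + fischer (dirDeriv v p) (dirDeriv v p) := by
  rw [fischer_linForm_mul, Derivation.leibniz, dirDeriv_linForm, smul_eq_mul, smul_eq_mul,
    add_comm, mul_comm p, ← smul_eq_C_mul]
  change fischerLin p _ = _
  rw [map_add, map_smul, smul_eq_mul]
  change _ + fischer p _ = _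
  rw [fischer_comm p, fischer_linForm_mul]
  rfl

/-- The Fischer norm of the product is the permanent of the Gram matrix of the vectors, so this is
the bound `1 ≤ per G` for a positive semidefinite `G` with unit diagonal. -/
theorem one_le_fischer_prodLinForm (l : List (σ → ℝ)) (hl : ∀ v ∈ l, ∑ s, v s * v s = 1) :
    1 ≤ fischer (prodLinForm l) (prodLinForm l) := by
  induction l with
  | nil => simp [prodLinForm, fischer]
  | cons v l ih =>
    rw [List.forall_mem_cons] at hl
    have h : prodLinForm (v :: l) = linForm v * prodLinForm l := by simp [prodLinForm]
    rw [h, fischer_linForm_mul_self, hl.1]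
    linarith [ih hl.2, fischer_self_nonneg (dirDeriv v (prodLinForm l))]

/-! ### Wick products -/

namespace DegLT

variable {m : ℕ} {p : MvPolynomial σ ℝ}

theorem dirDeriv (v : σ → ℝ) (hp : DegLT (m + 1) p) : DegLT m (dirDeriv v p) := fun α hα => by
  rw [dirDeriv_eq_sum, coeff_sum]
  refine Finset.sum_eq_zero fun s _ => ?_
  rw [coeff_smul, coeff_pderiv, hp _ (by simpa [map_add] using hα)]
  simp

theorem linForm_mul (v : σ → ℝ) (hp : DegLT m p) : DegLT (m + 1) (linForm v * p) := fun α hα => by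
  classical
  rw [linForm, Finset.sum_mul, coeff_sum]
  refine Finset.sum_eq_zero fun s _ => ?_
  rw [smul_mul_assoc, coeff_smul, coeff_X_mul']
  split_ifs with hs
  · have h1 : Finsupp.single s 1 ≤ α := by
      rw [Finsupp.single_le_iff]
      exact Nat.one_le_iff_ne_zero.2 (Finsupp.mem_support_iff.1 hs)
    have h2 : (α - Finsupp.single s 1).degree + 1 = α.degree := by
      conv_rhs => rw [← tsub_add_cancel_of_le h1]
      simp [map_add]
    rw [hp _ (by omega), smul_zero]
  · simp

end DegLT

/-- The Wick product of linear forms: their product, corrected by terms of lower degree so as to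
be orthogonal, for the Gaussian law, to all polynomials of lower degree. -/
noncomputable def wick : List (σ → ℝ) → MvPolynomial σ ℝ
  | [] => 1
  | v :: l => linForm v * wick l - dirDeriv v (wick l)

theorem prodLinForm_degLT (l : List (σ → ℝ)) : DegLT (l.length + 1) (prodLinForm l) := by
  induction l with
  | nil =>
    classical
    intro α hα
    rw [prodLinForm, List.map_nil, List.prod_nil, ← C_1, coeff_C, if_neg]
    rintro rfl
    simp at hα
  | cons v l ih => simpa [prodLinForm] using ih.linForm_mul v

theorem wick_sub_prodLinForm_degLT (l : List (σ → ℝ)) :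
    DegLT l.length (wick l - prodLinForm l) := by
  induction l with
  | nil => intro α _; simp [wick, prodLinForm]
  | cons v l ih =>
    have h : wick (v :: l) - prodLinForm (v :: l) =
        linForm v * (wick l - prodLinForm l) - dirDeriv v (wick l) := by
      simp only [wick, prodLinForm, List.map_cons, List.prod_cons]; ring
    have hw : DegLT (l.length + 1) (wick l) := by
      simpa using (ih.mono (Nat.le_succ _)).add (prodLinForm_degLT l)
    rw [h]
    exact (ih.linForm_mul v).sub ((hw.dirDeriv v).mono (Nat.le_succ _))

/-- Wick products represent the Fischer form: moving each factor across by integration by parts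
turns it into a derivative of `q`, and derivatives of full order do not see the Gaussian law. -/
theorem gaussE_wick_mul (l : List (σ → ℝ)) (q : MvPolynomial σ ℝ) (hq : DegLT (l.length + 1) q) :
    gaussE (wick l * q) = fischer (prodLinForm l) q := by
  induction l generalizing q with
  | nil =>
    rw [hq.eq_C]
    simp [wick, prodLinForm, gaussE_C, fischer]
  | cons v l ih =>
    have h1 : wick (v :: l) * q = linForm v * (wick l * q) - dirDeriv v (wick l) * q := by
      simp only [wick]; ring
    have h2 : prodLinForm (v :: l) = linForm v * prodLinForm l := by simp [prodLinForm]
    rw [h1, h2, fischer_linForm_mul, ← ih _ (hq.dirDeriv v), map_sub, gaussE_linForm_mul,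
      Derivation.leibniz, map_add, smul_eq_mul, smul_eq_mul, mul_comm q]
    ring

theorem fischer_prodLinForm_eq_zero (l : List (σ → ℝ)) (q : MvPolynomial σ ℝ)
    (hq : DegLT l.length q) : fischer (prodLinForm l) q = 0 := by
  induction l generalizing q with
  | nil => simp [hq.eq_zero, fischer]
  | cons v l ih =>
    have h2 : prodLinForm (v :: l) = linForm v * prodLinForm l := by simp [prodLinForm]
    rw [h2, fischer_linForm_mul, ih _ (hq.dirDeriv v)]

/-- The second Gaussian moment of a product of linear forms is at least its Fischer norm, which is
the second moment of its Wick product. -/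
theorem fischer_le_gaussE_sq (l : List (σ → ℝ)) :
    fischer (prodLinForm l) (prodLinForm l) ≤ gaussE (prodLinForm l * prodLinForm l) := by
  have hd := wick_sub_prodLinForm_degLT l
  have hw : DegLT (l.length + 1) (wick l) := by
    simpa using (hd.mono (Nat.le_succ _)).add (prodLinForm_degLT l)
  have h1 := gaussE_wick_mul l _ (prodLinForm_degLT l)
  have h2 := gaussE_wick_mul l _ hw
  have h3 : fischer (prodLinForm l) (wick l) = fischer (prodLinForm l) (prodLinForm l) := by
    have h := fischer_prodLinForm_eq_zero l _ hd
    change fischerLin (prodLinForm l) _ = 0 at h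
    rw [map_sub] at h
    exact sub_eq_zero.1 h
  have h4 := gaussE_sq_nonneg (prodLinForm l - wick l)
  -- `0 ≤ E[(p - W)²]` with `E[W p] = E[W²] = ⟨p, p⟩`, where `W` is the Wick product of `p`
  have h5 : (prodLinForm l - wick l) * (prodLinForm l - wick l) =
      prodLinForm l * prodLinForm l - 2 • (wick l * prodLinForm l) + wick l * wick l := by
    rw [two_nsmul]; ring
  rw [h5, map_add, map_sub, map_nsmul, h1, h2, h3, two_nsmul] at h4
  linarith

/-- The Gaussian product inequality for squares: for unit vectors `vᵢ` and a standard Gaussian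
vector `g`, the expectation of `∏ᵢ ⟨vᵢ, g⟩²` is at least `1`. -/
theorem one_le_gaussE_prod_linForm_sq {ι : Type*} (I : Finset ι) (v : ι → σ → ℝ)
    (hv : ∀ i ∈ I, ∑ s, v i s * v i s = 1) : 1 ≤ gaussE (∏ i ∈ I, linForm (v i) ^ 2) := by
  have h : ∏ i ∈ I, linForm (v i) ^ 2 =
      prodLinForm (I.toList.map v) * prodLinForm (I.toList.map v) := by
    rw [Finset.prod_pow, ← Finset.prod_map_toList, prodLinForm, List.map_map, sq]; rfl
  rw [h]
  refine (one_le_fischer_prodLinForm _ ?_).trans (fischer_le_gaussE_sq _)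
  simpa using hv

end GaussianPolynomials

/-! ### Averaging over a real inner product space -/

/-- Averaging a polynomial inequality over the standard Gaussian measure of a real inner product
space: each product of sums of `|τ|` squares expands into `|τ| ^ k` products of squares, whose
expectations are at least `1`. -/
theorem sum_mul_pow_le_of_forall_le {V ι τ : Type*} [NormedAddCommGroup V] [InnerProductSpace ℝ V]
    [FiniteDimensional ℝ V] [Fintype τ] (u : ι → τ → V) (hu : ∀ i t, ‖u i t‖ = 1) (k : ℕ)
    (S : Finset (Finset ι)) (hS : ∀ I ∈ S, I.card = k) (c : Finset ι → ℝ) (hc : ∀ I ∈ S, 0 ≤ c I)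
    (lam : ℝ)
    (h : ∀ y : V, ∑ I ∈ S, c I * ∏ i ∈ I, ∑ t, (inner ℝ (u i t) y) ^ 2 ≤ lam * ‖y‖ ^ (2 * k)) :
    (∑ I ∈ S, c I) * (Fintype.card τ : ℝ) ^ k ≤
      lam * ∏ j ∈ Finset.range k, ((Module.finrank ℝ V : ℝ) + 2 * j) := by
  classical
  let b := stdOrthonormalBasis ℝ V
  let w : ι → τ → Fin (Module.finrank ℝ V) → ℝ := fun i t s => b.repr (u i t) s
  have hw : ∀ i t, ∑ s, w i t s * w i t s = 1 := fun i t => by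
    have h1 := EuclideanSpace.norm_sq_eq (b.repr (u i t))
    rw [LinearIsometryEquiv.norm_map, hu] at h1
    simpa [sq, w] using h1.symm
  have key := gaussE_mono (p := ∑ I ∈ S, C (c I) * ∏ i ∈ I, ∑ t, linForm (w i t) ^ 2)
    (q := C lam * normSqPoly _ ^ k) fun x => by
      have hx := h (b.repr.symm (WithLp.toLp 2 x))
      have hi : ∀ v : V, inner ℝ v (b.repr.symm (WithLp.toLp 2 x)) =
          ∑ s, b.repr v s * x s := fun v => by
        rw [← b.repr.inner_map_map, LinearIsometryEquiv.apply_symm_apply]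
        simp [PiLp.inner_apply, mul_comm]
      simp only [hi, LinearIsometryEquiv.norm_map, pow_mul, EuclideanSpace.norm_sq_eq,
        Real.norm_eq_abs, sq_abs] at hx
      simpa [linForm, normSqPoly, smul_eval, w] using hx
  rw [← smul_eq_C_mul, map_smul, gaussE_normSqPoly_pow, Fintype.card_fin, smul_eq_mul] at key
  refine le_trans ?_ key
  rw [map_sum, Finset.sum_mul]
  refine Finset.sum_le_sum fun I hI => ?_
  rw [← smul_eq_C_mul, map_smul, smul_eq_mul]
  refine mul_le_mul_of_nonneg_left ?_ (hc I hI)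
  rw [Finset.prod_sum, map_sum]
  have hcard : (Fintype.card τ : ℝ) ^ k = ∑ _p ∈ I.pi fun _ => (Finset.univ : Finset τ), (1 : ℝ) := by
    rw [Finset.sum_const, Finset.card_pi, Finset.prod_const, hS I hI]
    simp
  rw [hcard]
  exact Finset.sum_le_sum fun p _ =>
    one_le_gaussE_prod_linForm_sq I.attach (fun i => w i.1 (p i.1 i.2)) fun i _ => hw _ _

/-! ### Rank-one forms -/

section RankOne

variable {𝕜 : Type*} [RCLike 𝕜] {n : ℕ}

theorem hermForm_vecMulVec (v x : EuclideanSpace 𝕜 (Fin n)) :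
    hermForm (Matrix.vecMulVec v.ofLp (star v.ofLp)) x = ‖inner 𝕜 v x‖ ^ 2 := by
  have h1 : inner 𝕜 v x = star v.ofLp ⬝ᵥ x.ofLp := by
    rw [EuclideanSpace.inner_eq_star_dotProduct, dotProduct_comm]
  have h2 : star x.ofLp ⬝ᵥ v.ofLp = star (inner 𝕜 v x) := by
    rw [h1, Matrix.star_dotProduct]
  rw [hermForm, Matrix.vecMulVec_mulVec, ← h1, dotProduct_smul, h2]
  rw [op_smul_eq_mul, RCLike.star_def, RCLike.conj_mul]
  norm_cast

/-- `|⟨v, x⟩|²` is a sum of squares of real inner products with the unit multiples of `v` by an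
orthonormal basis of `𝕜` over `ℝ`. -/
theorem hermForm_vecMulVec_eq_sum (v x : EuclideanSpace 𝕜 (Fin n)) :
    hermForm (Matrix.vecMulVec v.ofLp (star v.ofLp)) x =
      ∑ t, (inner ℝ (stdOrthonormalBasis ℝ 𝕜 t • v) x) ^ 2 := by
  have h : ∀ z : 𝕜, inner ℝ (z • v) x = inner ℝ z (inner 𝕜 v x) := fun z => by
    rw [PiLp.inner_apply, PiLp.inner_apply, inner_sum]
    refine Finset.sum_congr rfl fun i _ => ?_
    simp [real_inner_eq_re_inner, RCLike.inner_apply, mul_comm, mul_left_comm]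
  rw [hermForm_vecMulVec, ← (stdOrthonormalBasis ℝ 𝕜).sum_sq_norm_inner_right]
  simp [h]

theorem finrank_real_euclideanSpace :
    Module.finrank ℝ (EuclideanSpace 𝕜 (Fin n)) = Module.finrank ℝ 𝕜 * n := by
  rw [← Module.finrank_mul_finrank ℝ 𝕜, finrank_euclideanSpace_fin]

end RankOne

/-! ### Sums of squares and feasibility -/

section SumsOfSquares

variable {𝕜 : Type*} [RCLike 𝕜] {n : ℕ} {f g : EuclideanSpace 𝕜 (Fin n) → ℝ}

theorem IsSOS.nonneg (hf : IsSOS f) (x : EuclideanSpace 𝕜 (Fin n)) : 0 ≤ f x := by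
  obtain ⟨m, s, -, h⟩ := hf
  rw [h]
  positivity

theorem IsSOS.of_fintype {ι : Type*} [Fintype ι] (s : ι → EuclideanSpace 𝕜 (Fin n) → ℝ)
    (hs : ∀ j, s j ∈ realPolyFun 𝕜 n) (h : ∀ x, f x = ∑ j, s j x ^ 2) : IsSOS f :=
  ⟨Fintype.card ι, fun j => s ((Fintype.equivFin ι).symm j), fun _ => hs _, fun x => by
    rw [h, ← (Fintype.equivFin ι).symm.sum_comp]⟩

theorem IsSOS.of_sq (hf : f ∈ realPolyFun 𝕜 n) : IsSOS (f ^ 2) :=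
  IsSOS.of_fintype (ι := Unit) (fun _ => f) (fun _ => hf) fun x => by simp

theorem IsSOS.zero : IsSOS (0 : EuclideanSpace 𝕜 (Fin n) → ℝ) :=
  IsSOS.of_fintype (ι := Empty) (fun j => j.elim) (fun j => j.elim) fun x => by simp

theorem IsSOS.add (hf : IsSOS f) (hg : IsSOS g) : IsSOS (f + g) := by
  obtain ⟨m, s, hs, h⟩ := hf
  obtain ⟨m', s', hs', h'⟩ := hg
  refine IsSOS.of_fintype (ι := Fin m ⊕ Fin m') (Sum.elim s s') ?_ fun x => by simp [h, h']
  rintro (j | j)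
  exacts [hs j, hs' j]

theorem IsSOS.mul (hf : IsSOS f) (hg : IsSOS g) : IsSOS (f * g) := by
  obtain ⟨m, s, hs, h⟩ := hf
  obtain ⟨m', s', hs', h'⟩ := hg
  refine IsSOS.of_fintype (ι := Fin m × Fin m') (fun j => s j.1 * s' j.2)
    (fun j => mul_mem (hs _) (hs' _)) fun x => ?_
  simp only [Pi.mul_apply, h, h', Finset.sum_mul_sum, Fintype.sum_prod_type, mul_pow]

theorem IsSOS.sum {ι : Type*} (S : Finset ι) (f : ι → EuclideanSpace 𝕜 (Fin n) → ℝ)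
    (hf : ∀ i ∈ S, IsSOS (f i)) : IsSOS (∑ i ∈ S, f i) :=
  Finset.sum_induction _ IsSOS (fun _ _ => IsSOS.add) IsSOS.zero hf

theorem IsSOS.const {c : ℝ} (hc : 0 ≤ c) :
    IsSOS (fun _ : EuclideanSpace 𝕜 (Fin n) => c) :=
  IsSOS.of_fintype (ι := Unit) (fun _ => algebraMap ℝ _ (√c))
    (fun _ => Subalgebra.algebraMap_mem _ _) fun x => by simp [Real.sq_sqrt hc]

theorem IsSOS.pow (hf : IsSOS f) (m : ℕ) : IsSOS (f ^ m) := by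
  induction m with
  | zero => exact IsSOS.const zero_le_one
  | succ m ih => rw [pow_succ]; exact ih.mul hf

/-- A `𝕜`-valued function whose real and imaginary parts are real polynomials. -/
def IsPolyFun (F : EuclideanSpace 𝕜 (Fin n) → 𝕜) : Prop :=
  (fun x => RCLike.re (F x)) ∈ realPolyFun 𝕜 n ∧ (fun x => RCLike.im (F x)) ∈ realPolyFun 𝕜 n

theorem IsPolyFun.coord (i : Fin n) : IsPolyFun fun x : EuclideanSpace 𝕜 (Fin n) => x i :=
  ⟨Algebra.subset_adjoin (.inl ⟨i, rfl⟩), Algebra.subset_adjoin (.inr ⟨i, rfl⟩)⟩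

theorem IsPolyFun.const (c : 𝕜) : IsPolyFun fun _ : EuclideanSpace 𝕜 (Fin n) => c :=
  ⟨Subalgebra.algebraMap_mem _ (RCLike.re c), Subalgebra.algebraMap_mem _ (RCLike.im c)⟩

theorem IsPolyFun.mul {F G : EuclideanSpace 𝕜 (Fin n) → 𝕜} (hF : IsPolyFun F) (hG : IsPolyFun G) :
    IsPolyFun fun x => F x * G x := by
  constructor
  · simp only [RCLike.mul_re]
    exact sub_mem (mul_mem hF.1 hG.1) (mul_mem hF.2 hG.2)
  · simp only [RCLike.mul_im]
    exact add_mem (mul_mem hF.1 hG.2) (mul_mem hF.2 hG.1)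

theorem IsPolyFun.sub {F G : EuclideanSpace 𝕜 (Fin n) → 𝕜} (hF : IsPolyFun F) (hG : IsPolyFun G) :
    IsPolyFun fun x => F x - G x := by
  constructor
  · simp only [map_sub]
    exact sub_mem hF.1 hG.1
  · simp only [map_sub]
    exact sub_mem hF.2 hG.2

theorem IsPolyFun.inner (v : EuclideanSpace 𝕜 (Fin n)) :
    IsPolyFun fun x : EuclideanSpace 𝕜 (Fin n) => Inner.inner 𝕜 v x := by
  have h : ∀ i, IsPolyFun fun x : EuclideanSpace 𝕜 (Fin n) => x i * star (v i) := fun i =>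
    (IsPolyFun.coord i).mul (IsPolyFun.const _)
  simp only [PiLp.inner_apply, RCLike.inner_apply]
  constructor
  · simp only [map_sum]
    convert sum_mem (t := Finset.univ) fun i _ => (h i).1 using 1
    ext x; simp
  · simp only [map_sum]
    convert sum_mem (t := Finset.univ) fun i _ => (h i).2 using 1
    ext x; simp

theorem IsPolyFun.isSOS_norm_sq {F : EuclideanSpace 𝕜 (Fin n) → 𝕜} (hF : IsPolyFun F) :
    IsSOS fun x => ‖F x‖ ^ 2 := by
  convert (IsSOS.of_sq hF.1).add (IsSOS.of_sq hF.2) using 1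
  ext x
  rw [RCLike.norm_sq_eq_def]
  simp [sq]

theorem isSOS_normSq : IsSOS fun x : EuclideanSpace 𝕜 (Fin n) => ‖x‖ ^ 2 := by
  convert IsSOS.sum Finset.univ _ fun i _ => (IsPolyFun.coord (𝕜 := 𝕜) (n := n) i).isSOS_norm_sq
  simp [EuclideanSpace.norm_sq_eq]

theorem isSOS_hermForm_vecMulVec (v : EuclideanSpace 𝕜 (Fin n)) :
    IsSOS (hermForm (Matrix.vecMulVec v.ofLp (star v.ofLp))) := by
  convert (IsPolyFun.inner v).isSOS_norm_sq using 1
  ext x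
  exact hermForm_vecMulVec v x

/-- For a unit vector `v`, `‖x‖² - |⟨v, x⟩|² = ‖x - ⟨v, x⟩ v‖²` is a sum of squares. -/
theorem isSOS_normSq_sub_hermForm (v : EuclideanSpace 𝕜 (Fin n)) (hv : ‖v‖ = 1) :
    IsSOS ((fun x : EuclideanSpace 𝕜 (Fin n) => ‖x‖ ^ 2) -
      hermForm (Matrix.vecMulVec v.ofLp (star v.ofLp))) := by
  convert IsSOS.sum Finset.univ _ fun i _ =>
    ((IsPolyFun.coord i).sub ((IsPolyFun.inner v).mul (IsPolyFun.const (v i)))).isSOS_norm_sq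
  ext x
  have h1 : ‖x - (inner 𝕜 v x : 𝕜) • v‖ ^ 2 = ‖x‖ ^ 2 - ‖(inner 𝕜 v x : 𝕜)‖ ^ 2 := by
    rw [@norm_sub_sq 𝕜, inner_smul_right, ← inner_conj_symm x v, RCLike.mul_conj, norm_smul, hv]
    norm_cast
    ring
  rw [Pi.sub_apply, hermForm_vecMulVec, ← h1, EuclideanSpace.norm_sq_eq]
  simp

/-- Telescoping: `N ^ (m + 1) - h P = N ^ m (N - h) + h (N ^ m - P)` with `N = ‖x‖²`. -/
theorem isSOS_normSq_pow_sub_prod {ι : Type*} (v : ι → EuclideanSpace 𝕜 (Fin n))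
    (hv : ∀ i, ‖v i‖ = 1) (I : Finset ι) :
    IsSOS ((fun x : EuclideanSpace 𝕜 (Fin n) => ‖x‖ ^ 2) ^ I.card -
      ∏ i ∈ I, hermForm (Matrix.vecMulVec (v i).ofLp (star (v i).ofLp))) := by
  classical
  induction I using Finset.induction_on with
  | empty => simpa using IsSOS.zero
  | insert i I hi ih =>
    rw [Finset.prod_insert hi, Finset.card_insert_of_notMem hi]
    convert ((isSOS_normSq.pow I.card).mul (isSOS_normSq_sub_hermForm (v i) (hv i))).add
      ((isSOS_hermForm_vecMulVec (v i)).mul ih) using 1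
    ring

/-- The relaxation is feasible, so that the infimum defining its value is over a nonempty set. -/
theorem isSOSFeasible_one {d k : ℕ} (hkd : k ≤ d) (v : Fin d → EuclideanSpace 𝕜 (Fin n))
    (hv : ∀ i, ‖v i‖ = 1) :
    IsSOSFeasible (fun i => Matrix.vecMulVec (v i).ofLp (star (v i).ofLp)) k 1 fun _ => 1 where
  pos _ _ := one_pos
  one_le_prod := by simp
  isSOS := by
    have hC : (d.choose k : ℝ) ≠ 0 := by exact_mod_cast (Nat.choose_pos hkd).ne'
    convert (IsSOS.const (inv_nonneg.2 (Nat.cast_nonneg (d.choose k)))).mul (IsSOS.sum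
      (Finset.powersetCard k (Finset.univ : Finset (Fin d))) _
      fun I _ => isSOS_normSq_pow_sub_prod v hv I) using 1
    ext x
    have h : ∑ I ∈ Finset.powersetCard k (Finset.univ : Finset (Fin d)), (‖x‖ ^ 2) ^ I.card =
        d.choose k * (‖x‖ ^ 2) ^ k := by
      rw [Finset.sum_congr rfl fun I hI => by rw [(Finset.mem_powersetCard.1 hI).2]]
      simp
    simp [Finset.sum_sub_distrib, h, mul_sub, pow_mul, hC]

end SumsOfSquares

/-! ### The bound -/

/-- The arithmetic-geometric mean inequality for `n, n + 2, …, n + 2k - 2`, by pairing each factor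
with its mirror image. -/
theorem prod_range_add_two_mul_le (n : ℝ) (hn : 0 ≤ n) (k : ℕ) :
    ∏ j ∈ Finset.range k, (n + 2 * j) ≤ (n + k - 1) ^ k := by
  rcases Nat.eq_zero_or_pos k with rfl | hk
  · simp
  have hk1 : (1 : ℝ) ≤ k := by exact_mod_cast hk
  refine le_of_sq_le_sq ?_ (by apply pow_nonneg; linarith)
  rw [← pow_mul, mul_comm k 2, pow_mul, sq (∏ j ∈ _, _)]
  conv_lhs => enter [2]; rw [← Finset.prod_range_reflect]
  rw [← Finset.prod_mul_distrib]
  calc _ ≤ ∏ _j ∈ Finset.range k, (n + k - 1) ^ 2 := by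
        refine Finset.prod_le_prod (fun j _ => by positivity) fun j hj => ?_
        have h : ((k - 1 - j : ℕ) : ℝ) = k - 1 - j := by
          have := Finset.mem_range.1 hj
          rw [Nat.cast_sub (by omega), Nat.cast_sub (by omega)]
          simp
        rw [h]
        nlinarith [sq_nonneg ((k : ℝ) - 1 - 2 * j)]
    _ = _ := by simp

/-- Positive weights with product at least `1` have arithmetic mean at least `1`. -/
theorem card_le_sum_of_one_le_prod {ι : Type*} (S : Finset ι) (α : ι → ℝ) (hα : ∀ i ∈ S, 0 < α i)
    (h : 1 ≤ ∏ i ∈ S, α i) : (S.card : ℝ) ≤ ∑ i ∈ S, α i := by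
  have h1 : 0 ≤ ∑ i ∈ S, Real.log (α i) := by
    rw [← Real.log_prod fun i hi => (hα i hi).ne']
    exact Real.log_nonneg h
  have h2 : ∑ i ∈ S, Real.log (α i) ≤ ∑ i ∈ S, (α i - 1) :=
    Finset.sum_le_sum fun i hi => Real.log_le_sub_one_of_pos (hα i hi)
  simp at h2
  linarith

/-- The lower bound for every feasible point, obtained by averaging over the Gaussian measure of `𝕜ⁿ`
as a real space of dimension `m n`, where `m` is the dimension of `𝕜` over `ℝ`. -/
theorem one_le_mul_pow_of_isSOSFeasible {𝕜 : Type*} [RCLike 𝕜] {n d k : ℕ} (hkd : k ≤ d)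
    (v : Fin d → EuclideanSpace 𝕜 (Fin n)) (hv : ∀ i, ‖v i‖ = 1) {lam : ℝ} {α : Finset (Fin d) → ℝ}
    (h : IsSOSFeasible (fun i => Matrix.vecMulVec (v i).ofLp (star (v i).ofLp)) k lam α) :
    1 ≤ lam * ((n : ℝ) + k - 1) ^ k := by
  set S := Finset.powersetCard k (Finset.univ : Finset (Fin d)) with hS
  have hC : 0 < (d.choose k : ℝ) := by exact_mod_cast Nat.choose_pos hkd
  have hcard : (S.card : ℝ) = d.choose k := by simp [hS]
  set m := Module.finrank ℝ 𝕜
  have hm : (1 : ℝ) ≤ m := by exact_mod_cast Module.finrank_pos (R := ℝ) (M := 𝕜)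
  have key := sum_mul_pow_le_of_forall_le (fun i t => stdOrthonormalBasis ℝ 𝕜 t • v i)
    (fun i t => by simp [norm_smul, hv]) k S (fun I hI => (Finset.mem_powersetCard.1 hI).2)
    (fun I => (d.choose k : ℝ)⁻¹ * α I)
    (fun I hI => mul_nonneg (inv_nonneg.2 hC.le) (h.pos I hI).le) lam fun y => by
      have hy := h.isSOS.nonneg y
      simp only [hermForm_vecMulVec_eq_sum, Finset.mul_sum, ← mul_assoc] at hy
      linarith
  rw [← Finset.mul_sum, finrank_real_euclideanSpace, Fintype.card_fin] at key
  have h1 : 1 ≤ (d.choose k : ℝ)⁻¹ * ∑ I ∈ S, α I := by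
    rw [← div_eq_inv_mul, one_le_div hC, ← hcard]
    exact card_le_sum_of_one_le_prod S α h.pos h.one_le_prod
  have hmk : (0 : ℝ) < (m : ℝ) ^ k := by positivity
  have h2 : ∏ j ∈ Finset.range k, (((m * n : ℕ) : ℝ) + 2 * j) ≤ m ^ k * ((n : ℝ) + k - 1) ^ k :=
    calc _ ≤ ∏ j ∈ Finset.range k, ((m : ℝ) * (n + 2 * j)) := by
          refine Finset.prod_le_prod (fun j _ => by positivity) fun j _ => ?_
          push_cast
          nlinarith [mul_le_mul_of_nonneg_right hm (by positivity : (0 : ℝ) ≤ 2 * j)]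
      _ = m ^ k * ∏ j ∈ Finset.range k, ((n : ℝ) + 2 * j) := by simp [Finset.prod_mul_distrib]
      _ ≤ _ := mul_le_mul_of_nonneg_left (prod_range_add_two_mul_le n n.cast_nonneg k) hmk.le
  have h3 : (m : ℝ) ^ k ≤ lam * ∏ j ∈ Finset.range k, (((m * n : ℕ) : ℝ) + 2 * j) :=
    (le_mul_of_one_le_left hmk.le h1).trans key
  have hlam : 0 ≤ lam := by
    by_contra hneg
    have : 0 ≤ ∏ j ∈ Finset.range k, (((m * n : ℕ) : ℝ) + 2 * j) := by positivity
    nlinarith [mul_nonneg (neg_nonneg.2 (not_le.1 hneg).le) this]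
  have h4 := h3.trans (mul_le_mul_of_nonneg_left h2 hlam)
  exact le_of_mul_le_mul_left (by linarith) hmk

theorem mainTheorem9 {𝕜 : Type*} [RCLike 𝕜] (n d k : ℕ) (hk : 1 ≤ k) (hkd : k ≤ d)
    (v : Fin d → EuclideanSpace 𝕜 (Fin n)) (hv : ∀ i, ‖v i‖ = 1) :
    1 / ((n : ℝ) + (k : ℝ) - 1) ≤
      optSOS (fun i => Matrix.vecMulVec (v i).ofLp (star (v i).ofLp)) k := by
  have hn : (1 : ℝ) ≤ n := by
    rcases Nat.eq_zero_or_pos n with rfl | hn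
    · have := hv ⟨0, by omega⟩
      simp [Subsingleton.elim (v ⟨0, by omega⟩) 0] at this
    · exact_mod_cast hn
  have hk1 : (1 : ℝ) ≤ k := by exact_mod_cast hk
  have hpos : (0 : ℝ) < n + k - 1 := by linarith
  refine le_csInf ⟨_, 1, _, isSOSFeasible_one hkd v hv, rfl⟩ ?_
  rintro _ ⟨lam, α, h, rfl⟩
  have h1 := one_le_mul_pow_of_isSOSFeasible hkd v hv h
  have h2 : (1 / ((n : ℝ) + k - 1)) ^ k ≤ lam := by
    rw [one_div, inv_pow, inv_le_iff_one_le_mul₀ (by positivity)]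
    exact h1
  calc 1 / ((n : ℝ) + k - 1) = ((1 / ((n : ℝ) + k - 1)) ^ k) ^ (1 / (k : ℝ)) := by
        rw [one_div (k : ℝ), Real.pow_rpow_inv_natCast (by positivity) (by omega)]
    _ ≤ _ := Real.rpow_le_rpow (by positivity) h2 (by positivity)
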